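/- Let $q$ be even, let $\alpha_1,\dots,\alpha_{q-1}$ be pairwise distinct elements of $\mathbb{F}_q^*$ and let $v_1,\dots,v_{q+2}\in\mathbb{F}_q^*$ (not necessarily distinct). Let $\mathcal{C}=\{\mathbf{x}\in\mathbb{F}_q^{q+2} : \widetilde{H}\mathbf{x}^{tr}=0\}$ be the generalized triple-extended Reed–Solomon (GTRS) code with the $3\times(q+2)$ parity check matrix $$\widetilde{H}=\begin{bmatrix}1&\cdots&1&1&0&0\\ \alpha_1&\cdots&\alpha_{q-1}&0&0&1\\ \alpha_1^2&\cdots&\alpha_{q-1}^2&0&1&0\end{bmatrix}\operatorname{diag}(v_1,\dots,v_{q+2}),$$ whose columns are the points of the regular hyperoval in $\mathrm{PG}(2,q)$. For a set $\mathcal{V}$ of words let $B_w(\mathcal{V})$ be the number of vectors of Hamming weight $w$ in $\mathcal{V}$, put $A_w(\mathcal{C})=B_w(\mathcal{C})$, and let the weight of a coset of $\mathcal{C}$ be the smallest Hamming weight of a vector in it. Put $n=q+2$, $d=4$ and $\Omega_w^{(v)}(\mathcal{C})=(-1)^{w-d}\binom{n-v}{w-v}\binom{w-1-v}{d-2-v}$.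 Then: 1. $\mathcal{C}$ has length $q+2$, dimension $q-1$, minimum distance $4$ and covering radius $2$. 2. $\mathcal{C}$ has exactly $(q-1)(q^2-1)$ cosets of weight $2$. 3. Every coset $\mathcal{V}$ of weight $2$ has the weight distribution $B_0(\mathcal{V})=B_1(\mathcal{V})=0$, $B_2(\mathcal{V})=\frac{q+2}{2}$ and, for $w=3,4,\dots,q+2$, $$B_w(\mathcal{V})=A_w(\mathcal{C})-\Omega_w^{(0)}(\mathcal{C})+\Omega_w^{(2)}(\mathcal{C})\,\frac{q+2}{2}=A_w(\mathcal{C})-\Omega_w^{(0)}(\mathcal{C})+(-1)^{w}\binom{q}{q+2-w}\,\frac{q+2}{2}.$$ 4. $\mathcal{C}$ is a $\left(2,\frac{q+2}{2}\right)$ perfect multiple covering of the farthest-off points; that is, its covering radius is $2$, its minimum distance is at least $4$, and every $\mathbf{x}\in\mathbb{F}_q^{q+2}$ at Hamming distance $2$ from $\mathcal{C}$ has exactly $\frac{q+2}{2}$ codewords at distance $2$. -/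

import Mathlib

/-- The (linear) code over `F` with parity check matrix `H`: all words `x` with `H xᵗʳ = 0`. -/
def parityCheckCode {F r ι : Type*} [Field F] [Fintype ι] (H : Matrix r ι F) :
    Submodule F (ι → F) :=
  LinearMap.ker H.mulVecLin

/-- The number of vectors of Hamming weight `w` in a set `V` of words. For `V` a code this is
`A_w(V)`; for `V` a coset of a code this is `B_w(V)`. -/
noncomputable def weightCount {F ι : Type*} [Field F] [DecidableEq F] [Fintype ι]
    (V : Set (ι → F)) (w : ℕ) : ℕ :=
  Set.ncard {x : ι → F | x ∈ V ∧ hammingNorm x = w}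

/-- `V` is a coset of the linear code `C`: `V = {c + v | c ∈ C}` for some fixed word `v`. -/
def IsCosetOf {F ι : Type*} [Field F] (C : Submodule F (ι → F)) (V : Set (ι → F)) : Prop :=
  ∃ v : ι → F, V = {x : ι → F | ∃ c ∈ C, x = c + v}

/-- The weight of a coset (or of any nonempty set of words): the smallest Hamming weight of any
vector in it. -/
noncomputable def cosetWeight {F ι : Type*} [Field F] [DecidableEq F] [Fintype ι]
    (V : Set (ι → F)) : ℕ :=
  sInf {w : ℕ | ∃ x ∈ V, hammingNorm x = w}

/-- The minimum distance of a code (with at least two codewords). -/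
noncomputable def codeMinDist {F ι : Type*} [Field F] [DecidableEq F] [Fintype ι]
    (C : Submodule F (ι → F)) : ℕ :=
  sInf {m : ℕ | ∃ x ∈ C, ∃ y ∈ C, x ≠ y ∧ hammingDist x y = m}

/-- The distance `d(x, C)` of a word from a code. -/
noncomputable def distToCode {F ι : Type*} [Field F] [DecidableEq F] [Fintype ι]
    (x : ι → F) (C : Submodule F (ι → F)) : ℕ :=
  sInf {m : ℕ | ∃ c ∈ C, hammingDist x c = m}

/-- The covering radius of a code: the least `R` such that the Hamming spheres of radius `R`
centred at the codewords cover the whole space. -/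
noncomputable def codeCoveringRadius {F ι : Type*} [Field F] [DecidableEq F] [Fintype ι]
    (C : Submodule F (ι → F)) : ℕ :=
  sInf {R : ℕ | ∀ x : ι → F, ∃ c ∈ C, hammingDist x c ≤ R}

/-- `C` is an `[n, k, d]_q R` code: linear of length `n`, dimension `k`, minimum distance `d` and
covering radius `R`. -/
def HasCodeParameters {F ι : Type*} [Field F] [DecidableEq F] [Fintype ι]
    (C : Submodule F (ι → F)) (n k d R : ℕ) : Prop :=
  Fintype.card ι = n ∧ Module.finrank F C = k ∧ codeMinDist C = d ∧ codeCoveringRadius C = R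

/-- `f_δ(x, C)`: the number of codewords at distance exactly `δ` from the word `x`. -/
noncomputable def codewordsAtDist {F ι : Type*} [Field F] [DecidableEq F] [Fintype ι]
    (δ : ℕ) (x : ι → F) (C : Submodule F (ι → F)) : ℕ :=
  Set.ncard {c : ι → F | c ∈ C ∧ hammingDist x c = δ}

/-- `C` is an `(R, μ)` almost perfect multiple covering of the farthest-off points: `C` has
covering radius `R` and every word at distance `R` from `C` has exactly `μ` codewords at
distance `R`. -/
def IsAPMCF {F ι : Type*} [Field F] [DecidableEq F] [Fintype ι]
    (C : Submodule F (ι → F)) (R μ : ℕ) : Prop :=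
  codeCoveringRadius C = R ∧
    ∀ x : ι → F, distToCode x C = R → codewordsAtDist R x C = μ

/-- `C` is an `(R, μ)` perfect multiple covering of the farthest-off points: it is an almost
perfect one and its minimum distance is at least `2R`. -/
def IsPMCF {F ι : Type*} [Field F] [DecidableEq F] [Fintype ι]
    (C : Submodule F (ι → F)) (R μ : ℕ) : Prop :=
  IsAPMCF C R μ ∧ 2 * R ≤ codeMinDist C

/-- The coefficient `Ω_w^{(v)} = (-1)^{w-d} * binom(n-v, w-v) * binom(w-1-v, d-2-v)` attached to
length `n` and distance `d`, used for `v ≤ d - 2` and `d - 1 ≤ w ≤ n`, where no subtraction below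
truncates. The sign is written `(-1)^{w+d}`, which has the same parity and also makes sense for
`w = d - 1`. -/
def bonneauOmega (n d w v : ℕ) : ℤ :=
  (-1) ^ (w + d) * ((n - v).choose (w - v) : ℤ) * ((w - 1 - v).choose (d - 2 - v) : ℤ)

/-- The `3 × (q + 2)` matrix with columns `(1, α_i, α_i²)` for `1 ≤ i ≤ q - 1`, followed by
`(1, 0, 0)`, `(0, 0, 1)` and `(0, 1, 0)`, with its columns multiplied by the scalars `v_j`.
For `α` an enumeration of the nonzero elements of the field, the columns are the points of the
regular hyperoval (the conic and its nucleus). -/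
def gtrsMatrix {F : Type*} [Field F] {m : ℕ} (α : Fin m → F) (v : Fin m ⊕ Fin 3 → F) :
    Matrix (Fin 3) (Fin m ⊕ Fin 3) F :=
  Matrix.fromCols
      (Matrix.of ![fun _ => 1, fun i => α i, fun i => α i ^ 2])
      !![1, 0, 0;
         0, 0, 1;
         0, 1, 0]
    * Matrix.diagonal v

/-!
The code is the kernel of the syndrome map `x ↦ H x`, and its cosets are the sets of words with a
given syndrome. Apart from the number of columns, `q + 2`, the only property of `H` used is that any
three columns are linearly independent (`TripleIndep`). This is where the hyperoval and
characteristic two enter (`hyperovalPoint_dotProduct_cross_ne_zero`, `tripleIndep_gtrsMatrix`).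

Independence of triples gives minimum distance `4` and surjectivity of the syndrome map, even on the
words supported on three given coordinates (`TripleIndep.exists_supported`). Together with the column
count it also gives the pairing property `TripleIndep.exists_pair`: for a syndrome `s` that is not
a multiple of the column `hᵢ`, some `hⱼ` with `j ≠ i` has `s` in the span of `hᵢ` and `hⱼ`. Hence
the covering radius is at most `2`, and the cosets of weight `2` belong to the syndromes that are
not a multiple of any column. There are `q ^ 3 - 1 - (q + 2) (q - 1) = (q - 1) (q ^ 2 - 1)` of
these. For such a syndrome each coordinate lies in the support of exactly one word of weight `2`
of the coset, so there are `(q + 2) / 2` such words (`TripleIndep.card_weight_two`).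

For the remaining weights, Möbius inversion on the lattice of supports expresses the number of words
of weight `w` with syndrome `s` in terms of the number of such words supported in each set `S` of
coordinates (`card_hammingNorm_eq_sum`). If `S` has at least three elements this number does not
depend on `s`. Subtracting the expansion for `s = 0` therefore leaves only the terms with at most
two elements, which are known (`TripleIndep.card_weight_sub`), and these sum to the coefficients `Ω`.
-/

/-! ### Supports of words -/

/-- The support of a word, as a finite set of coordinates; its cardinality is `hammingNorm x` by
definition. -/
def wordSupport {F ι : Type*} [Zero F] [DecidableEq F] [Fintype ι] (x : ι → F) : Finset ι :=
  {i | x i ≠ 0}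

section Words

variable {F ι : Type*} [Field F] [DecidableEq F] [Fintype ι]

theorem mem_wordSupport {x : ι → F} {i : ι} : i ∈ wordSupport x ↔ x i ≠ 0 := by
  simp [wordSupport]

theorem card_wordSupport (x : ι → F) : (wordSupport x).card = hammingNorm x := rfl

theorem hammingNorm_le_card_of_forall_notMem {x : ι → F} {S : Finset ι}
    (h : ∀ i, i ∉ S → x i = 0) : hammingNorm x ≤ S.card := by
  rw [← card_wordSupport]
  refine Finset.card_le_card fun i hi => ?_
  by_contra hiS
  exact mem_wordSupport.1 hi (h i hiS)

theorem exists_eq_single_of_hammingNorm_le_one [DecidableEq ι] [Nonempty ι] {x : ι → F}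
    (h : hammingNorm x ≤ 1) : ∃ j a, x = Pi.single j a := by
  rw [← card_wordSupport, Finset.card_le_one_iff_subset_singleton] at h
  obtain ⟨j, hj⟩ := h
  refine ⟨j, x j, funext fun i => ?_⟩
  by_cases hij : i = j
  · subst hij; simp
  · rw [Pi.single_eq_of_ne hij]
    by_contra hi
    exact hij (Finset.mem_singleton.1 (hj (mem_wordSupport.2 hi)))

theorem hammingNorm_single_le_one [DecidableEq ι] (j : ι) (a : F) :
    hammingNorm (Pi.single j a : ι → F) ≤ 1 := by
  refine (hammingNorm_le_card_of_forall_notMem (S := {j}) fun i hi => ?_).trans_eq (by simp)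
  rw [Pi.single_eq_of_ne (by simpa using hi)]

theorem hammingDist_eq_hammingNorm_sub (x y : ι → F) : hammingDist x y = hammingNorm (x - y) := by
  simp [hammingDist, hammingNorm, sub_eq_zero]

end Words

/-! ### Syndromes when any three columns are independent -/

section Syndromes

variable {F ι : Type*} [Field F] [DecidableEq F] [Fintype ι]

/-- Any three columns of the parity check map `φ` are linearly independent: no nonzero word of
weight at most `3` has syndrome `0`. -/
def TripleIndep (φ : (ι → F) →ₗ[F] (Fin 3 → F)) : Prop :=
  ∀ x, φ x = 0 → hammingNorm x ≤ 3 → x = 0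

/-- The syndrome `s` is not a multiple of a column of `φ`. For nonempty `ι` this also excludes
`s = 0`. -/
def IsFarSyndrome [DecidableEq ι] (φ : (ι → F) →ₗ[F] (Fin 3 → F)) (s : Fin 3 → F) : Prop :=
  ∀ j a, φ (Pi.single j a) ≠ s

variable {φ : (ι → F) →ₗ[F] (Fin 3 → F)}

/-- Two words with the same syndrome agree as soon as at most three coordinates can tell them
apart. -/
theorem TripleIndep.eq_of_forall_notMem (hφ : TripleIndep φ) {x y : ι → F} (hxy : φ x = φ y)
    {S : Finset ι} (hS : S.card ≤ 3) (h : ∀ i, i ∉ S → x i = y i) : x = y := by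
  refine sub_eq_zero.1 (hφ (x - y) (by rw [map_sub, hxy, sub_self]) ?_)
  exact (hammingNorm_le_card_of_forall_notMem fun i hi => by simp [h i hi]).trans hS

/-- Three independent columns span the space of syndromes, so every syndrome is attained on any
set of at least three coordinates. -/
theorem TripleIndep.exists_supported (hφ : TripleIndep φ) {S : Finset ι} (hS : 3 ≤ S.card)
    (s : Fin 3 → F) : ∃ x, (∀ i, i ∉ S → x i = 0) ∧ φ x = s := by
  obtain ⟨T, hTS, hT⟩ := Finset.exists_subset_card_eq hS
  let e := Function.ExtendByZero.linearMap F (Subtype.val : T → ι)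
  have he : ∀ (y : T → F) i, i ∉ T → e y i = 0 := fun y i hi =>
    Function.extend_apply' y (0 : ι → F) i fun ⟨a, ha⟩ => hi (ha ▸ a.2)
  have heT : ∀ (y : T → F) (i : T), e y i = y i := fun y i =>
    Subtype.val_injective.extend_apply y (0 : ι → F) i
  have hinj : Function.Injective (φ ∘ₗ e) := by
    refine (injective_iff_map_eq_zero _).2 fun y hy => ?_
    have h0 := hφ (e y) hy ((hammingNorm_le_card_of_forall_notMem (he y)).trans_eq hT)
    funext i
    rw [← heT y i, h0]
    rfl
  have hsurj := (LinearMap.injective_iff_surjective_of_finrank_eq_finrank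
    (by rw [Module.finrank_fintype_fun_eq_card, Module.finrank_fintype_fun_eq_card,
      Fintype.card_coe, Fintype.card_fin, hT])).1 hinj
  obtain ⟨y, hy⟩ := hsurj s
  exact ⟨e y, fun i hi => he y i fun h => hi (hTS h), hy⟩

theorem TripleIndep.surjective (hφ : TripleIndep φ) (hι : 3 ≤ Fintype.card ι) :
    Function.Surjective φ := fun s =>
  let ⟨x, _, hx⟩ := hφ.exists_supported (S := Finset.univ) hι s
  ⟨x, hx⟩

theorem TripleIndep.exists_hammingNorm_eq_four (hφ : TripleIndep φ) (hι : 4 ≤ Fintype.card ι) :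
    ∃ x, φ x = 0 ∧ hammingNorm x = 4 := by
  classical
  obtain ⟨S, -, hS⟩ := Finset.exists_subset_card_eq (s := (Finset.univ : Finset ι)) hι
  obtain ⟨i, hi⟩ : S.Nonempty := Finset.card_pos.1 (by omega)
  obtain ⟨y, hy, hys⟩ := hφ.exists_supported (S := S.erase i)
    (by rw [Finset.card_erase_of_mem hi, hS]) (φ (Pi.single i 1))
  have hx0 : φ (Pi.single i 1 - y) = 0 := by rw [map_sub, hys, sub_self]
  refine ⟨Pi.single i 1 - y, hx0, le_antisymm ?_ ?_⟩
  · refine (hammingNorm_le_card_of_forall_notMem fun j hj => ?_).trans_eq hS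
    have hji : j ≠ i := fun h => hj (h ▸ hi)
    simp [hji, hy j fun h => hj (Finset.mem_of_mem_erase h)]
  · by_contra hlt
    have := congrFun (hφ _ hx0 (by omega)) i
    simp [hy i (Finset.notMem_erase i S)] at this

variable [DecidableEq ι]

theorem hammingNorm_single_add_single_le_two (i j : ι) (a b : F) :
    hammingNorm (Pi.single i b + Pi.single j a : ι → F) ≤ 2 := by
  refine (hammingNorm_le_card_of_forall_notMem (S := {i, j}) fun k hk => ?_).trans
    Finset.card_le_two
  simp only [Finset.mem_insert, Finset.mem_singleton, not_or] at hk
  simp [hk.1, hk.2]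

theorem IsFarSyndrome.two_le_hammingNorm [Nonempty ι] {s : Fin 3 → F} (hs : IsFarSyndrome φ s)
    {x : ι → F} (hx : φ x = s) : 2 ≤ hammingNorm x := by
  by_contra h
  obtain ⟨j, a, rfl⟩ := exists_eq_single_of_hammingNorm_le_one (x := x) (by omega)
  exact hs j a hx

variable [Fintype F]

/-- The `q ^ 3 - q` vectors outside the line of the `i`-th column are exactly the combinations
`b hᵢ + a hⱼ` with `j ≠ i` and `a ≠ 0`: there are `(q + 1) (q - 1) q` of these, and they are
distinct since any three columns are independent. Geometrically, each of the `q + 1` lines through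
a point of a hyperoval contains exactly one further point of it. -/
theorem TripleIndep.exists_pair (hφ : TripleIndep φ)
    (hι : Fintype.card ι = Fintype.card F + 2) (i : ι) {s : Fin 3 → F}
    (hs : ∀ b, φ (Pi.single i b) ≠ s) :
    ∃ j a b, j ≠ i ∧ φ (Pi.single i b + Pi.single j a) = s := by
  let g : {j // j ≠ i} × Fˣ × F → ι → F := fun p =>
    Pi.single i p.2.2 + Pi.single p.1.1 (p.2.1 : F)
  have gi : ∀ p, g p i = p.2.2 := fun p => by simp [g, Pi.single_eq_of_ne p.1.2.symm]
  have gj : ∀ p (j : ι), j ≠ i → g p j = if j = p.1 then (p.2.1 : F) else 0 := fun p j hj => by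
    simp [g, hj, Pi.single_apply]
  have gS : ∀ p (j : ι), j ≠ i → j ≠ p.1 → g p j = 0 := fun p j hj hj' => by
    rw [gj p j hj, if_neg hj']
  have ginj : Function.Injective g := by
    intro p p' h
    have h2 : p.2.2 = p'.2.2 := by rw [← gi, ← gi, h]
    have h1 := congrFun h p.1
    rw [gj _ _ p.1.2, gj _ _ p.1.2, if_pos rfl] at h1
    split_ifs at h1 with hc
    · exact Prod.ext (Subtype.ext hc) (Prod.ext (Units.ext h1) h2)
    · exact absurd h1 p.2.1.ne_zero
  let G : {j // j ≠ i} × Fˣ × F → {t : Fin 3 → F // ∀ b, φ (Pi.single i b) ≠ t} := fun p =>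
    ⟨φ (g p), fun b hb => by
      have := hφ.eq_of_forall_notMem hb (S := {i, p.1.1}) (Finset.card_le_two.trans (by norm_num))
        fun j hj => by
          simp only [Finset.mem_insert, Finset.mem_singleton, not_or] at hj
          rw [gS p j hj.1 hj.2, Pi.single_eq_of_ne hj.1]
      have := congrFun this p.1
      rw [Pi.single_eq_of_ne p.1.2, gj _ _ p.1.2, if_pos rfl] at this
      exact p.2.1.ne_zero this.symm⟩
  have Ginj : Function.Injective G := fun p p' h => ginj <|
    hφ.eq_of_forall_notMem (congrArg Subtype.val h) (S := {i, p.1.1, p'.1.1}) Finset.card_le_three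
      fun j hj => by
        simp only [Finset.mem_insert, Finset.mem_singleton, not_or] at hj
        rw [gS p j hj.1 hj.2.1, gS p' j hj.1 hj.2.2]
  have hcard : Fintype.card ({j // j ≠ i} × Fˣ × F) =
      Fintype.card {t : Fin 3 → F // ∀ b, φ (Pi.single i b) ≠ t} := by
    have hcol : Fintype.card {t : Fin 3 → F // ∃ b, φ (Pi.single i b) = t} = Fintype.card F := by
      refine (Fintype.card_of_bijective (f := fun b => ⟨φ (Pi.single i b), b, rfl⟩)
        ⟨fun b b' h => ?_, fun ⟨t, b, hb⟩ => ⟨b, Subtype.ext hb⟩⟩).symm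
      have h := congrArg Subtype.val h
      have := hφ.eq_of_forall_notMem h (S := {i}) (by simp) fun j hj => by
        rw [Pi.single_eq_of_ne (by simpa using hj), Pi.single_eq_of_ne (by simpa using hj)]
      simpa using this
    have hcompl := Fintype.card_subtype_compl (fun t : Fin 3 → F => ∃ b, φ (Pi.single i b) = t)
    simp only [not_exists] at hcompl
    rw [hcompl, hcol, Fintype.card_prod, Fintype.card_prod, Fintype.card_units,
      Fintype.card_subtype_compl, hι]
    have hq : 1 ≤ Fintype.card F := Fintype.card_pos
    obtain ⟨r, hr⟩ := Nat.exists_eq_add_of_le hq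
    simp only [Fintype.card_unique, Fintype.card_fun, Fintype.card_fin, hr]
    rw [show 1 + r - 1 = r by omega, show 1 + r + 2 - 1 = r + 2 by omega]
    symm
    apply Nat.sub_eq_of_eq_add
    ring
  obtain ⟨p, hp⟩ := ((Fintype.bijective_iff_injective_and_card G).2 ⟨Ginj, hcard⟩).2 ⟨s, hs⟩
  exact ⟨p.1, p.2.1, p.2.2, p.1.2, congrArg Subtype.val hp⟩

theorem TripleIndep.exists_hammingNorm_le_two (hφ : TripleIndep φ)
    (hι : Fintype.card ι = Fintype.card F + 2) (s : Fin 3 → F) :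
    ∃ x, φ x = s ∧ hammingNorm x ≤ 2 := by
  obtain ⟨i⟩ : Nonempty ι := Fintype.card_pos_iff.1 (by omega)
  by_cases hs : ∀ b, φ (Pi.single i b) ≠ s
  · obtain ⟨j, a, b, -, h⟩ := hφ.exists_pair hι i hs
    exact ⟨_, h, hammingNorm_single_add_single_le_two i j a b⟩
  · push Not at hs
    obtain ⟨b, hb⟩ := hs
    exact ⟨_, hb, (hammingNorm_single_le_one i b).trans (by norm_num)⟩

open Finset in
/-- Each coordinate lies in the support of exactly one word of weight `2` with a given far
syndrome, so these supports partition the `q + 2` coordinates into pairs. -/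
theorem TripleIndep.card_weight_two (hφ : TripleIndep φ)
    (hι : Fintype.card ι = Fintype.card F + 2) {s : Fin 3 → F} (hs : IsFarSyndrome φ s) :
    2 * #{x : ι → F | φ x = s ∧ hammingNorm x = 2} = Fintype.card F + 2 := by
  have : Nonempty ι := Fintype.card_pos_iff.1 (by omega)
  have hone : ∀ i : ι, #{x ∈ ({x : ι → F | φ x = s ∧ hammingNorm x = 2} : Finset _) | x i ≠ 0}
      = 1 := by
    intro i
    rw [card_eq_one]
    obtain ⟨j, a, b, hji, h⟩ := hφ.exists_pair hι i (hs i)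
    have hb : b ≠ 0 := fun hb => hs j a (by simpa [hb] using h)
    refine ⟨Pi.single i b + Pi.single j a, eq_singleton_iff_unique_mem.2 ⟨?_, ?_⟩⟩
    · simp only [mem_filter, mem_univ, true_and]
      exact ⟨⟨h, (hammingNorm_single_add_single_le_two i j a b).antisymm
        (hs.two_le_hammingNorm h)⟩, by simpa [Pi.single_eq_of_ne hji.symm] using hb⟩
    · intro y hy
      simp only [mem_filter, mem_univ, true_and] at hy
      -- both supports have two elements and share `i`
      refine hφ.eq_of_forall_notMem (hy.1.1.trans h.symm) (S := insert j (wordSupport y)) ?_ ?_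
      · exact (card_insert_le _ _).trans (by rw [card_wordSupport, hy.1.2])
      · intro k hk
        simp only [mem_insert, mem_wordSupport, not_or, not_not] at hk
        have hki : k ≠ i := fun hki => hy.2 (hki ▸ hk.2)
        simp [hk.2, hk.1, hki]
  have hdc := sum_card_bipartiteAbove_eq_sum_card_bipartiteBelow
    (s := (univ : Finset ι)) (t := ({x : ι → F | φ x = s ∧ hammingNorm x = 2} : Finset _))
    (fun i x => x i ≠ 0)
  simp only [bipartiteAbove, bipartiteBelow, hone] at hdc
  have htwo : ∀ x ∈ ({x : ι → F | φ x = s ∧ hammingNorm x = 2} : Finset _), #{i | x i ≠ 0} = 2 :=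
    fun x hx => (mem_filter.1 hx).2.2
  rw [sum_congr rfl htwo] at hdc
  simp only [sum_const, card_univ, smul_eq_mul, hι] at hdc
  omega

open Finset in
/-- Of the `q ^ 3` syndromes, `1 + (q + 2) (q - 1)` are multiples of a column. -/
theorem TripleIndep.card_farSyndrome (hφ : TripleIndep φ)
    (hι : Fintype.card ι = Fintype.card F + 2) :
    Nat.card {s // IsFarSyndrome φ s} = (Fintype.card F - 1) * (Fintype.card F ^ 2 - 1) := by
  classical
  obtain ⟨i₀⟩ : Nonempty ι := Fintype.card_pos_iff.1 (by omega)
  -- the multiples of columns are zero and the vectors `a hⱼ` with `a ≠ 0`, all distinct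
  let G : Option (ι × Fˣ) → {s : Fin 3 → F // ∃ j a, φ (Pi.single j a) = s} := fun p =>
    p.elim ⟨0, i₀, 0, by simp⟩ fun p => ⟨φ (Pi.single p.1 (p.2 : F)), p.1, p.2, rfl⟩
  have hG : Function.Bijective G := by
    constructor
    · have key : ∀ (j : ι) (a : Fˣ) (j' : ι) (a' : F),
          φ (Pi.single j (a : F)) = φ (Pi.single j' a') → j = j' ∧ (a : F) = a' := by
        intro j a j' a' h
        have h := hφ.eq_of_forall_notMem h (S := {j, j'}) (card_le_two.trans (by norm_num))
          fun k hk => by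
            simp only [mem_insert, mem_singleton, not_or] at hk
            rw [Pi.single_eq_of_ne hk.1, Pi.single_eq_of_ne hk.2]
        have hj := congrFun h j
        rw [Pi.single_eq_same, Pi.single_apply] at hj
        split_ifs at hj with hjj
        · exact ⟨hjj, hj⟩
        · exact absurd hj a.ne_zero
      rintro (_ | ⟨j, a⟩) (_ | ⟨j', a'⟩) h
      · rfl
      · exact absurd (key j' a' j' 0 (by simpa [G] using (congrArg Subtype.val h).symm)).2
          a'.ne_zero
      · exact absurd (key j a j 0 (by simpa [G] using congrArg Subtype.val h)).2 a.ne_zero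
      · obtain ⟨h1, h2⟩ := key j a j' a' (congrArg Subtype.val h)
        rw [h1, Units.ext h2]
    · rintro ⟨s, j, a, rfl⟩
      by_cases ha : a = 0
      · exact ⟨none, Subtype.ext (by simp [G, ha])⟩
      · exact ⟨some (j, Units.mk0 a ha), rfl⟩
  have hnear := Fintype.card_of_bijective hG
  have hcompl := Fintype.card_subtype_compl (fun s : Fin 3 → F => ∃ j a, φ (Pi.single j a) = s)
  simp only [not_exists] at hcompl
  have hfar : Nat.card {s // IsFarSyndrome φ s} =
      Fintype.card {s // ∀ j a, ¬φ (Pi.single j a) = s} :=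
    Nat.card_eq_fintype_card (α := {s // ∀ j a, ¬φ (Pi.single j a) = s})
  rw [hfar, hcompl, ← hnear, Fintype.card_option, Fintype.card_prod, Fintype.card_units, hι]
  obtain ⟨r, hr⟩ := Nat.exists_eq_add_of_le (Fintype.card_pos (α := F))
  simp only [Fintype.card_fun, Fintype.card_fin, hr]
  rw [show 0 + 1 + r - 1 = r by omega,
    show (0 + 1 + r) ^ 2 - 1 = r ^ 2 + 2 * r from Nat.sub_eq_of_eq_add (by ring)]
  apply Nat.sub_eq_of_eq_add
  ring

end Syndromes

/-! ### Weight counts by Möbius inversion -/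

section Counting

open Finset

theorem sum_Icc_neg_one_pow_card {ι : Type*} [DecidableEq ι] {T W : Finset ι} (h : T ⊆ W) :
    ∑ S ∈ Icc T W, (-1 : ℤ) ^ (W.card + S.card) = if T = W then 1 else 0 := by
  have hinj : Set.InjOn (fun U => T ∪ U) ((W \ T).powerset : Set (Finset ι)) := by
    intro U hU U' hU' hUU
    have hd : ∀ U ∈ (W \ T).powerset, Disjoint T U := fun U hU =>
      (disjoint_sdiff (s := T) (t := W)).mono_right (mem_powerset.1 hU)
    rw [← union_sdiff_cancel_left (hd U hU), ← union_sdiff_cancel_left (hd U' hU')]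
    exact congrArg (· \ T) hUU
  rw [Icc_eq_image_powerset h, sum_image hinj]
  have hterm : ∀ U ∈ (W \ T).powerset, (-1 : ℤ) ^ (W.card + (T ∪ U).card) =
      (-1) ^ (W.card + T.card) * (-1) ^ U.card := fun U hU => by
    rw [card_union_of_disjoint
      ((disjoint_sdiff (s := T) (t := W)).mono_right (mem_powerset.1 hU)), ← pow_add, add_assoc]
  rw [sum_congr rfl hterm, ← mul_sum, sum_powerset_neg_one_pow_card]
  by_cases hTW : T = W
  · simp [hTW, ← two_mul]
  · have : W \ T ≠ ∅ := fun h' => hTW (h.antisymm (sdiff_eq_empty_iff_subset.1 h'))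
    simp [hTW, this]

theorem card_supersets {ι : Type*} [DecidableEq ι] [Fintype ι] {S : Finset ι} {w : ℕ}
    (h : S.card ≤ w) :
    #{W ∈ powersetCard w (univ : Finset ι) | S ⊆ W} =
      (Fintype.card ι - S.card).choose (w - S.card) := by
  rw [← card_compl, ← card_powersetCard]
  refine card_bij' (fun W _ => W \ S) (fun U _ => U ∪ S) ?_ ?_ ?_ ?_
  · intro W hW
    simp only [mem_filter, mem_powersetCard, subset_univ, true_and] at hW
    rw [mem_powersetCard, card_sdiff_of_subset hW.2, hW.1]
    exact ⟨fun x hx => mem_compl.2 (mem_sdiff.1 hx).2, rfl⟩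
  · intro U hU
    rw [mem_powersetCard] at hU
    have hd : Disjoint U S := disjoint_left.2 fun x hx => mem_compl.1 (hU.1 hx)
    simp only [mem_filter, mem_powersetCard, subset_univ, true_and]
    rw [card_union_of_disjoint hd, hU.2]
    exact ⟨by omega, subset_union_right⟩
  · intro W hW
    exact sdiff_union_of_subset (mem_filter.1 hW).2
  · intro U hU
    have hd : Disjoint U S := disjoint_left.2 fun x hx =>
      mem_compl.1 ((mem_powersetCard.1 hU).1 hx)
    rw [union_sdiff_right, sdiff_eq_self_of_disjoint hd]

variable {F ι : Type*} [Field F] [DecidableEq F] [Fintype ι] [DecidableEq ι]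

/-- Möbius inversion on the lattice of supports: the number of words of weight `w` in `A` in terms
of the numbers of words supported in each set of coordinates. -/
theorem card_hammingNorm_eq_sum (A : Finset (ι → F)) (w : ℕ) :
    (#{x ∈ A | hammingNorm x = w} : ℤ) =
      ∑ S : Finset ι, (-1) ^ (w + S.card) * (#{W ∈ powersetCard w (univ : Finset ι) | S ⊆ W} : ℤ) *
        #{x ∈ A | wordSupport x ⊆ S} := by
  have hx : ∀ x ∈ A, (if hammingNorm x = w then (1 : ℤ) else 0) =
      ∑ S : Finset ι, ∑ W ∈ powersetCard w (univ : Finset ι),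
        if S ⊆ W ∧ wordSupport x ⊆ S then (-1 : ℤ) ^ (w + S.card) else 0 := by
    intro x _
    have hW : ∀ W ∈ powersetCard w (univ : Finset ι),
        (∑ S : Finset ι, if S ⊆ W ∧ wordSupport x ⊆ S then (-1 : ℤ) ^ (w + S.card) else 0) =
          if wordSupport x = W then 1 else 0 := by
      intro W hW
      rw [← sum_filter]
      have : (univ.filter fun S => S ⊆ W ∧ wordSupport x ⊆ S) = Icc (wordSupport x) W := by
        ext S; simp [and_comm]
      rw [this]
      by_cases hsub : wordSupport x ⊆ W
      · rw [← sum_Icc_neg_one_pow_card hsub, (mem_powersetCard.1 hW).2]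
      · rw [Icc_eq_empty (by simpa using hsub), if_neg fun h => hsub h.le, sum_empty]
    rw [sum_comm, sum_congr rfl hW, sum_ite_eq]
    simp [mem_powersetCard, card_wordSupport]
  rw [card_filter, Nat.cast_sum]
  simp only [Nat.cast_ite, Nat.cast_one, Nat.cast_zero]
  rw [sum_congr rfl hx, sum_comm]
  refine sum_congr rfl fun S _ => ?_
  rw [sum_comm]
  simp only [card_filter, Nat.cast_sum, Nat.cast_ite, Nat.cast_one, Nat.cast_zero]
  rw [mul_assoc, sum_mul_sum, mul_sum]
  refine sum_congr rfl fun W _ => ?_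
  rw [mul_sum]
  refine sum_congr rfl fun x _ => ?_
  by_cases h1 : S ⊆ W <;> by_cases h2 : wordSupport x ⊆ S <;> simp [h1, h2]

variable [Fintype F] {φ : (ι → F) →ₗ[F] (Fin 3 → F)}

/-- On at least three coordinates, the words with syndrome `s` are a translate of those with
syndrome `0`. -/
theorem TripleIndep.card_supported_eq (hφ : TripleIndep φ) {S : Finset ι} (hS : 3 ≤ S.card)
    (s : Fin 3 → F) :
    #{x ∈ ({x : ι → F | φ x = s} : Finset _) | wordSupport x ⊆ S} =
      #{x ∈ ({x : ι → F | φ x = 0} : Finset _) | wordSupport x ⊆ S} := by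
  obtain ⟨y, hy, hys⟩ := hφ.exists_supported hS s
  have hsupp : ∀ x : ι → F, wordSupport x ⊆ S ↔ ∀ i, i ∉ S → x i = 0 := fun x => by
    simp only [subset_iff, mem_wordSupport]
    exact forall_congr' fun i => not_imp_comm
  refine card_bij' (fun x _ => x - y) (fun x _ => x + y) ?_ ?_ (by simp) (by simp)
  · intro x hx
    simp only [mem_filter, mem_univ, true_and, hsupp] at hx ⊢
    exact ⟨by rw [map_sub, hx.1, hys, sub_self], fun i hi => by simp [hx.2 i hi, hy i hi]⟩
  · intro x hx
    simp only [mem_filter, mem_univ, true_and, hsupp] at hx ⊢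
    exact ⟨by rw [map_add, hx.1, hys, zero_add], fun i hi => by simp [hx.2 i hi, hy i hi]⟩

theorem TripleIndep.card_supported_zero (hφ : TripleIndep φ) {S : Finset ι} (hS : S.card ≤ 3) :
    #{x ∈ ({x : ι → F | φ x = 0} : Finset _) | wordSupport x ⊆ S} = 1 := by
  rw [card_eq_one]
  refine ⟨0, eq_singleton_iff_unique_mem.2 ⟨?_, fun x hx => ?_⟩⟩
  · simp [wordSupport]
  · simp only [mem_filter, mem_univ, true_and] at hx
    exact hφ x hx.1 ((card_le_card hx.2).trans hS)

theorem IsFarSyndrome.card_supported_eq_zero [Nonempty ι] {s : Fin 3 → F}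
    (hs : IsFarSyndrome φ s) {S : Finset ι} (hS : S.card ≤ 1) :
    #{x ∈ ({x : ι → F | φ x = s} : Finset _) | wordSupport x ⊆ S} = 0 := by
  rw [card_eq_zero, filter_eq_empty_iff]
  intro x hx hxS
  have h1 := hs.two_le_hammingNorm (mem_filter.1 hx).2
  have h2 := card_le_card hxS
  rw [card_wordSupport] at h2
  omega

theorem IsFarSyndrome.sum_card_supported [Nonempty ι] {s : Fin 3 → F} (hs : IsFarSyndrome φ s) :
    ∑ S ∈ powersetCard 2 (univ : Finset ι),
      #{x ∈ ({x : ι → F | φ x = s} : Finset _) | wordSupport x ⊆ S} =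
        #{x : ι → F | φ x = s ∧ hammingNorm x = 2} := by
  rw [card_eq_sum_card_fiberwise (f := wordSupport) (t := powersetCard 2 (univ : Finset ι))
    fun x hx => by
      simp only [coe_filter, mem_univ, true_and, Set.mem_ofPred_eq] at hx
      simpa [mem_powersetCard, card_wordSupport] using hx.2]
  refine sum_congr rfl fun S hS => congrArg card ?_
  ext x
  simp only [mem_filter, mem_univ, true_and]
  have hS2 := (mem_powersetCard.1 hS).2
  constructor
  · rintro ⟨hx, hxS⟩
    have := eq_of_subset_of_card_le hxS (by
      rw [hS2, card_wordSupport]; exact hs.two_le_hammingNorm hx)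
    exact ⟨⟨hx, by rw [← card_wordSupport, this, hS2]⟩, this⟩
  · rintro ⟨⟨hx, -⟩, hxS⟩
    exact ⟨hx, hxS.le⟩

/-- Both weight distributions are expanded by Möbius inversion. Supports of at least three
coordinates contribute equally to both, so only the supports of size `0`, `1`, `2` are left. -/
theorem TripleIndep.card_weight_sub (hφ : TripleIndep φ) [Nonempty ι] {s : Fin 3 → F}
    (hs : IsFarSyndrome φ s) {w : ℕ} (hw : 2 ≤ w) :
    (#{x : ι → F | φ x = s ∧ hammingNorm x = w} : ℤ) -
        #{x : ι → F | φ x = 0 ∧ hammingNorm x = w} =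
      (-1) ^ w * ((Fintype.card ι - 2).choose (w - 2) *
          (#{x : ι → F | φ x = s ∧ hammingNorm x = 2} - (Fintype.card ι).choose 2)
        + Fintype.card ι * (Fintype.card ι - 1).choose (w - 1) - (Fintype.card ι).choose w) := by
  let N : (Fin 3 → F) → Finset ι → ℤ := fun t S =>
    #{x ∈ ({x : ι → F | φ x = t} : Finset _) | wordSupport x ⊆ S}
  let c : Finset ι → ℤ := fun S =>
    (-1) ^ (w + S.card) * (#{W ∈ powersetCard w (univ : Finset ι) | S ⊆ W} : ℤ)
  have hc : ∀ S : Finset ι, S.card ≤ 2 → c S =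
      (-1) ^ (w + S.card) * ((Fintype.card ι - S.card).choose (w - S.card) : ℤ) := fun S hS => by
    simp only [c, card_supersets (hS.trans hw)]
  have hB : ∀ t, (#{x : ι → F | φ x = t ∧ hammingNorm x = w} : ℤ) = ∑ S, c S * N t S := fun t => by
    rw [← filter_filter]
    exact card_hammingNorm_eq_sum _ w
  have hbig : ∀ S, S ∉ (range 3).biUnion (fun j => powersetCard j (univ : Finset ι)) →
      c S * (N s S - N 0 S) = 0 := fun S hS => by
    simp only [mem_biUnion, mem_range, mem_powersetCard, subset_univ, true_and, exists_eq_right',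
      not_lt] at hS
    simp only [N, hφ.card_supported_eq hS s, sub_self, mul_zero]
  have hdisj : ∀ j ∈ range 3, ∀ k ∈ range 3, j ≠ k →
      Disjoint (powersetCard j (univ : Finset ι)) (powersetCard k univ) := fun j _ k _ hjk =>
    disjoint_left.2 fun S h h' => hjk ((mem_powersetCard.1 h).2.symm.trans (mem_powersetCard.1 h').2)
  have hsmall : ∀ j ≤ 1, ∑ S ∈ powersetCard j (univ : Finset ι), c S * (N s S - N 0 S) =
      -((Fintype.card ι).choose j * ((-1) ^ (w + j) * ((Fintype.card ι - j).choose (w - j) : ℤ))) := by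
    intro j hj
    rw [sum_congr rfl (g := fun _ => -((-1) ^ (w + j) *
      ((Fintype.card ι - j).choose (w - j) : ℤ))) fun S hS => ?_]
    · simp [card_univ]
    · have hSj := (mem_powersetCard.1 hS).2
      rw [hc S (by omega)]
      simp only [N, hs.card_supported_eq_zero (S := S) (by omega),
        hφ.card_supported_zero (S := S) (by omega), hSj]
      simp
  have htwo : ∑ S ∈ powersetCard 2 (univ : Finset ι), c S * (N s S - N 0 S) =
      (-1) ^ w * ((Fintype.card ι - 2).choose (w - 2) : ℤ) *
        (#{x : ι → F | φ x = s ∧ hammingNorm x = 2} - (Fintype.card ι).choose 2) := by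
    rw [← hs.sum_card_supported, Nat.cast_sum, ← card_univ (α := ι), ← card_powersetCard 2,
      card_eq_sum_ones (powersetCard 2 univ), Nat.cast_sum, ← sum_sub_distrib, mul_sum]
    refine sum_congr rfl fun S hS => ?_
    have hS2 := (mem_powersetCard.1 hS).2
    rw [hc S hS2.le]
    simp only [N, hφ.card_supported_zero (S := S) (by omega), hS2, pow_add, card_univ]
    simp
  rw [hB, hB, ← sum_sub_distrib]
  simp only [← mul_sub]
  rw [← sum_subset (subset_univ _) fun S _ hS => hbig S hS, sum_biUnion hdisj, sum_range_succ,
    sum_range_succ, sum_range_one, hsmall 0 zero_le_one, hsmall 1 le_rfl, htwo]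
  simp only [Nat.choose_zero_right, Nat.choose_one_right, pow_add]
  push_cast
  simp only [Nat.sub_zero]
  ring

end Counting

/-! ### The coefficients `Ω` for minimum distance four -/

/-- The contribution of the supports of size at most `2` in closed form: with `d = 4`, it is
`Ω_w^{(0)} = (-1)^w (binom n w - n binom (n-1) (w-1) + binom n 2 binom (n-2) (w-2))`, because
`binom n j binom (n-j) (w-j) = binom n w binom w j`. -/
theorem bonneauOmega_four_zero {n w : ℕ} (hw : 3 ≤ w) (hwn : w ≤ n) :
    bonneauOmega n 4 w 0 = (-1) ^ w * ((n.choose w : ℤ) - n * (n - 1).choose (w - 1)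
      + n.choose 2 * (n - 2).choose (w - 2)) := by
  have h1 := Nat.choose_mul (n := n) (show 1 ≤ w by omega)
  have h2 := Nat.choose_mul (n := n) (show 2 ≤ w by omega)
  have h3 : ((w - 1).choose 2 : ℤ) = 1 - w + w.choose 2 := by
    obtain ⟨k, rfl⟩ := Nat.exists_eq_add_of_le' (show 1 ≤ w by omega)
    have := Nat.choose_succ_succ k 1
    rw [Nat.choose_one_right] at this
    rw [Nat.add_sub_cancel, this]
    push_cast
    ring
  rw [Nat.choose_one_right, Nat.choose_one_right] at h1
  have h1' : (n.choose w : ℤ) * w = n * (n - 1).choose (w - 1) := mod_cast h1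
  have h2' : (n.choose w : ℤ) * w.choose 2 = n.choose 2 * (n - 2).choose (w - 2) := mod_cast h2
  simp only [bonneauOmega, Nat.sub_zero, show 4 - 2 = 2 from rfl]
  rw [h3, ← h1', ← h2', pow_add]
  ring

theorem choose_sub_two_eq {q w : ℕ} (hw : 2 ≤ w) (hwq : w ≤ q + 2) :
    q.choose (w - 2) = q.choose (q + 2 - w) := by
  rw [← Nat.choose_symm (show w - 2 ≤ q by omega)]
  congr 1
  omega

theorem bonneauOmega_four_two {q w : ℕ} (hw : 3 ≤ w) (hwq : w ≤ q + 2) :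
    bonneauOmega (q + 2) 4 w 2 = (-1) ^ w * (q.choose (q + 2 - w) : ℤ) := by
  simp [bonneauOmega, pow_add, choose_sub_two_eq (show 2 ≤ w by omega) hwq]

/-! ### The regular hyperoval -/

section Hyperoval

variable {F : Type*} [Field F]

/-- The points of the regular hyperoval: the affine points `(1, t, t²)` of the conic, its point at
infinity `(0, 0, 1)` (for `false`), and its nucleus `(0, 1, 0)` (for `true`). -/
def hyperovalPoint : F ⊕ Bool → Fin 3 → F
  | .inl t => ![1, t, t ^ 2]
  | .inr false => ![0, 0, 1]
  | .inr true => ![0, 1, 0]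

open scoped Matrix in
/-- In characteristic two no three points of the regular hyperoval are collinear. The
characteristic enters through the secants of the conic, which miss the nucleus because `s ≠ t`
gives `s + t ≠ 0`. -/
theorem hyperovalPoint_dotProduct_cross_ne_zero [CharP F 2] {x y z : F ⊕ Bool} (hxy : x ≠ y)
    (hxz : x ≠ z) (hyz : y ≠ z) :
    (hyperovalPoint x ⨯₃ hyperovalPoint y) ⬝ᵥ hyperovalPoint z ≠ 0 := by
  have hsub : ∀ {s t : F}, s ≠ t → s - t ≠ 0 := sub_ne_zero.2
  have hsq : ∀ {s t : F}, s ≠ t → s ^ 2 - t ^ 2 ≠ 0 := fun {s t} h => by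
    rw [sq_sub_sq, Ne, mul_eq_zero, CharTwo.add_eq_zero, not_or]
    exact ⟨h, hsub h⟩
  rcases x with s | _ | _ <;> rcases y with t | _ | _ <;> rcases z with u | _ | _ <;>
    simp [hyperovalPoint, cross_apply] at hxy hxz hyz ⊢
  · intro h
    refine mul_ne_zero (mul_ne_zero (hsub hxy) (hsub hxz)) (hsub hyz) ?_
    linear_combination -h
  · exact hsub (Ne.symm hxy)
  · exact hsq hxy
  · simpa [← sub_eq_add_neg] using hsub hxz
  · simpa [neg_add_eq_sub] using hsq (Ne.symm hxz)
  · simpa [neg_add_eq_sub] using hsub (Ne.symm hyz)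
  · simpa [← sub_eq_add_neg] using hsq hyz

/-- The map sending a column index of the parity check matrix to its hyperoval point. -/
def hyperovalIndex {m : ℕ} (α : Fin m → F) : Fin m ⊕ Fin 3 → F ⊕ Bool :=
  Sum.elim (fun i => .inl (α i)) ![.inl 0, .inr false, .inr true]

theorem hyperovalIndex_injective {m : ℕ} {α : Fin m → F} (hα : Function.Injective α)
    (hα0 : ∀ i, α i ≠ 0) : Function.Injective (hyperovalIndex α) := by
  rintro (i | i) (j | j) h
  · exact congrArg _ (hα (by simpa [hyperovalIndex] using h))
  · fin_cases j <;> simp [hyperovalIndex, hα0] at h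
  · fin_cases i <;> simp [hyperovalIndex, (hα0 _).symm] at h
  · fin_cases i <;> fin_cases j <;> simp [hyperovalIndex] at h ⊢

theorem gtrsMatrix_apply {m : ℕ} (α : Fin m → F) (v : Fin m ⊕ Fin 3 → F) (r : Fin 3)
    (j : Fin m ⊕ Fin 3) : gtrsMatrix α v r j = hyperovalPoint (hyperovalIndex α j) r * v j := by
  rw [gtrsMatrix, Matrix.mul_diagonal]
  congr 1
  rcases j with i | j
  · fin_cases r <;> simp [hyperovalIndex, hyperovalPoint]
  · fin_cases r <;> fin_cases j <;> simp [hyperovalIndex, hyperovalPoint]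

theorem dotProduct_gtrsMatrix_mulVec {m : ℕ} (α : Fin m → F) (v x : Fin m ⊕ Fin 3 → F)
    (f : Fin 3 → F) : f ⬝ᵥ (gtrsMatrix α v).mulVec x =
      ∑ j, (f ⬝ᵥ hyperovalPoint (hyperovalIndex α j)) * (v j * x j) := by
  simp only [dotProduct, Matrix.mulVec, gtrsMatrix_apply, Finset.mul_sum, Finset.sum_mul]
  rw [Finset.sum_comm]
  exact Finset.sum_congr rfl fun j _ => Finset.sum_congr rfl fun r _ => by ring

open scoped Matrix in
/-- If `x` had syndrome `0` and support inside `{k, i, j}` with `x k ≠ 0`, the line through the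
points with indices `i`, `j` would contain the one with index `k`. -/
theorem tripleIndep_gtrsMatrix [DecidableEq F] [CharP F 2] {m : ℕ} {α : Fin m → F}
    (hα : Function.Injective α) (hα0 : ∀ i, α i ≠ 0) {v : Fin m ⊕ Fin 3 → F}
    (hv : ∀ j, v j ≠ 0) : TripleIndep (gtrsMatrix α v).mulVecLin := by
  intro x hx hx3
  obtain ⟨T, hxT, hT⟩ := Finset.exists_superset_card_eq (s := wordSupport x) (n := 3) hx3
    (by simp)
  funext k
  by_contra hk
  have hkT : k ∈ T := hxT (mem_wordSupport.2 hk)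
  obtain ⟨i, j, hij, hT2⟩ := Finset.card_eq_two.1
    (show (T.erase k).card = 2 by rw [Finset.card_erase_of_mem hkT, hT])
  have hi : i ≠ k := Finset.ne_of_mem_erase (hT2 ▸ Finset.mem_insert_self i {j})
  have hj : j ≠ k := Finset.ne_of_mem_erase (hT2 ▸ by simp : j ∈ T.erase k)
  have hinj := hyperovalIndex_injective hα hα0
  let p := fun l => hyperovalPoint (hyperovalIndex α l)
  have hsum := dotProduct_gtrsMatrix_mulVec α v x (p i ⨯₃ p j)
  rw [show (gtrsMatrix α v).mulVec x = 0 from hx, dotProduct_zero,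
    Finset.sum_eq_single k ?_ (by simp)] at hsum
  · exact mul_ne_zero (hyperovalPoint_dotProduct_cross_ne_zero (hinj.ne hij) (hinj.ne hi)
      (hinj.ne hj)) (mul_ne_zero (hv k) hk) hsum.symm
  · intro l _ hlk
    by_cases hl : l ∈ T.erase k
    · rw [hT2, Finset.mem_insert, Finset.mem_singleton] at hl
      rcases hl with rfl | rfl
      · rw [dotProduct_comm, dot_self_cross, zero_mul]
      · rw [dotProduct_comm, dot_cross_self, zero_mul]
    · have : x l = 0 := by
        by_contra hxl
        exact hl (Finset.mem_erase.2 ⟨hlk, hxT (mem_wordSupport.2 hxl)⟩)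
      rw [this, mul_zero, mul_zero]

end Hyperoval

/-! ### Cosets, covering radius and weight distribution -/

section Cosets

variable {F ι : Type*} [Field F] {φ : (ι → F) →ₗ[F] (Fin 3 → F)}

/-- The cosets of `ker φ` are the sets of words with a given syndrome. -/
theorem isCosetOf_ker_iff (hφ : Function.Surjective φ) {V : Set (ι → F)} :
    IsCosetOf (LinearMap.ker φ) V ↔ ∃ s, V = {x | φ x = s} := by
  have h : ∀ u, {x | ∃ c ∈ LinearMap.ker φ, x = c + u} = {x | φ x = φ u} := fun u => by
    ext x
    constructor
    · rintro ⟨c, hc, rfl⟩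
      simp [LinearMap.mem_ker.1 hc]
    · intro hx
      exact ⟨x - u, by simpa [sub_eq_zero] using hx, by simp⟩
  simp only [IsCosetOf, h]
  exact ⟨fun ⟨u, hu⟩ => ⟨φ u, hu⟩, fun ⟨s, hs⟩ => let ⟨u, hu⟩ := hφ s; ⟨u, hu ▸ hs⟩⟩

end Cosets

section Parameters

variable {F ι : Type*} [Field F] [DecidableEq F] [Fintype ι] {φ : (ι → F) →ₗ[F] (Fin 3 → F)}

theorem TripleIndep.codeMinDist_ker (hφ : TripleIndep φ) (hι : 4 ≤ Fintype.card ι) :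
    codeMinDist (LinearMap.ker φ) = 4 := by
  obtain ⟨x, hx, hx4⟩ := hφ.exists_hammingNorm_eq_four hι
  refine IsLeast.csInf_eq ⟨⟨x, hx, 0, zero_mem _, ?_, by rw [hammingDist_zero_right, hx4]⟩, ?_⟩
  · rintro rfl
    simp at hx4
  · rintro _ ⟨y, hy, z, hz, hyz, rfl⟩
    rw [hammingDist_eq_hammingNorm_sub]
    by_contra! h
    exact hyz (sub_eq_zero.1 (hφ (y - z) (sub_mem hy hz) (by omega)))

theorem TripleIndep.finrank_ker (hφ : TripleIndep φ) (hι : 3 ≤ Fintype.card ι) :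
    Module.finrank F (LinearMap.ker φ) = Fintype.card ι - 3 := by
  have h := φ.finrank_range_add_finrank_ker
  rw [LinearMap.range_eq_top.2 (hφ.surjective hι), finrank_top,
    Module.finrank_fintype_fun_eq_card, Module.finrank_fintype_fun_eq_card, Fintype.card_fin] at h
  omega

/-- The words `x - c` with `c` in the code are the words with the syndrome of `x`. -/
theorem distToCode_ker (x : ι → F) :
    distToCode x (LinearMap.ker φ) = cosetWeight {y | φ y = φ x} := by
  unfold distToCode cosetWeight
  congr 1
  ext w
  constructor
  · rintro ⟨c, hc, rfl⟩
    exact ⟨x - c, by simp [LinearMap.mem_ker.1 hc], (hammingDist_eq_hammingNorm_sub x c).symm⟩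
  · rintro ⟨y, hy, rfl⟩
    have hy : φ y = φ x := hy
    exact ⟨x - y, by simp [hy], by simp [hammingDist_eq_hammingNorm_sub]⟩

theorem codewordsAtDist_ker (δ : ℕ) (x : ι → F) :
    codewordsAtDist δ x (LinearMap.ker φ) = weightCount {y | φ y = φ x} δ := by
  refine Set.ncard_congr (fun c _ => x - c) ?_ (fun _ _ _ _ h => sub_right_injective h) ?_
  · rintro c ⟨hc, rfl⟩
    exact ⟨by simp [LinearMap.mem_ker.1 hc], (hammingDist_eq_hammingNorm_sub x c).symm⟩
  · rintro y ⟨hy, rfl⟩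
    have hy : φ y = φ x := hy
    exact ⟨x - y, ⟨by simp [hy], by simp [hammingDist_eq_hammingNorm_sub]⟩, by simp⟩

variable [DecidableEq ι] [Fintype F]

theorem TripleIndep.cosetWeight_eq_two_iff (hφ : TripleIndep φ)
    (hι : Fintype.card ι = Fintype.card F + 2) (s : Fin 3 → F) :
    cosetWeight {x | φ x = s} = 2 ↔ IsFarSyndrome φ s := by
  have : Nonempty ι := Fintype.card_pos_iff.1 (by omega)
  obtain ⟨x, hx, hx2⟩ := hφ.exists_hammingNorm_le_two hι s
  constructor
  · intro h j a hja
    have hle : cosetWeight {x | φ x = s} ≤ hammingNorm (Pi.single j a : ι → F) :=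
      Nat.sInf_le ⟨_, hja, rfl⟩
    have := hammingNorm_single_le_one j a
    omega
  · intro hs
    refine IsLeast.csInf_eq (s := {w | ∃ x ∈ {x | φ x = s}, hammingNorm x = w})
      ⟨⟨x, hx, hx2.antisymm (hs.two_le_hammingNorm hx)⟩, ?_⟩
    rintro _ ⟨y, hy, rfl⟩
    exact hs.two_le_hammingNorm hy

theorem TripleIndep.ncard_cosets_weight_two (hφ : TripleIndep φ)
    (hι : Fintype.card ι = Fintype.card F + 2) :
    Set.ncard {V : Set (ι → F) | IsCosetOf (LinearMap.ker φ) V ∧ cosetWeight V = 2} =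
      (Fintype.card F - 1) * (Fintype.card F ^ 2 - 1) := by
  have hsurj := hφ.surjective (by have := Fintype.card_pos (α := F); omega)
  have himage : {V : Set (ι → F) | IsCosetOf (LinearMap.ker φ) V ∧ cosetWeight V = 2} =
      (fun s => {x | φ x = s}) '' {s | IsFarSyndrome φ s} := by
    ext V
    simp only [isCosetOf_ker_iff hsurj]
    constructor
    · rintro ⟨⟨s, rfl⟩, h⟩
      exact ⟨s, (hφ.cosetWeight_eq_two_iff hι s).1 h, rfl⟩
    · rintro ⟨s, hs, rfl⟩
      exact ⟨⟨s, rfl⟩, (hφ.cosetWeight_eq_two_iff hι s).2 hs⟩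
  have hinj : Function.Injective fun s => {x | φ x = s} := fun s t h => by
    obtain ⟨x, rfl⟩ := hsurj s
    exact (Set.ext_iff.1 h x).1 rfl
  rw [himage, Set.ncard_image_of_injective _ hinj, ← Nat.card_coe_set_eq]
  exact hφ.card_farSyndrome hι

theorem TripleIndep.exists_farSyndrome (hφ : TripleIndep φ)
    (hι : Fintype.card ι = Fintype.card F + 2) : ∃ s, IsFarSyndrome φ s := by
  have hq := Fintype.one_lt_card (α := F)
  have h : 0 < Nat.card {s // IsFarSyndrome φ s} := by
    rw [hφ.card_farSyndrome hι]
    exact Nat.mul_pos (by omega) (Nat.sub_pos_of_lt (Nat.one_lt_pow two_ne_zero hq))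
  obtain ⟨s⟩ := (Nat.card_pos_iff.1 h).1
  exact ⟨s.1, s.2⟩

theorem TripleIndep.codeCoveringRadius_ker (hφ : TripleIndep φ)
    (hι : Fintype.card ι = Fintype.card F + 2) : codeCoveringRadius (LinearMap.ker φ) = 2 := by
  have : Nonempty ι := Fintype.card_pos_iff.1 (by omega)
  have hq := Fintype.card_pos (α := F)
  refine IsLeast.csInf_eq (s := {R | ∀ x, ∃ c ∈ LinearMap.ker φ, hammingDist x c ≤ R})
    ⟨fun x => ?_, fun R hR => ?_⟩
  · obtain ⟨y, hy, hy2⟩ := hφ.exists_hammingNorm_le_two hι (φ x)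
    exact ⟨x - y, by simp [hy], by simpa [hammingDist_eq_hammingNorm_sub] using hy2⟩
  · obtain ⟨s, hs⟩ := hφ.exists_farSyndrome hι
    obtain ⟨x, hx⟩ := hφ.surjective (by omega) s
    obtain ⟨c, hc, hcR⟩ := hR x
    rw [hammingDist_eq_hammingNorm_sub] at hcR
    exact (hs.two_le_hammingNorm (by rw [map_sub, hx, LinearMap.mem_ker.1 hc, sub_zero])).trans hcR

theorem weightCount_syndrome (s : Fin 3 → F) (w : ℕ) :
    weightCount {x | φ x = s} w =
      (Finset.univ.filter fun x : ι → F => φ x = s ∧ hammingNorm x = w).card := by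
  rw [weightCount, ← Set.ncard_coe_finset]
  simp

theorem IsFarSyndrome.weightCount_eq_zero [Nonempty ι] {s : Fin 3 → F} (hs : IsFarSyndrome φ s)
    {w : ℕ} (hw : w < 2) : weightCount {x | φ x = s} w = 0 := by
  rw [weightCount_syndrome, Finset.card_eq_zero, Finset.filter_eq_empty_iff]
  rintro x - ⟨hx, rfl⟩
  exact absurd (hs.two_le_hammingNorm hx) (by omega)

theorem TripleIndep.weightCount_two (hφ : TripleIndep φ)
    (hι : Fintype.card ι = Fintype.card F + 2) {s : Fin 3 → F} (hs : IsFarSyndrome φ s) :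
    weightCount {x | φ x = s} 2 = (Fintype.card F + 2) / 2 := by
  rw [weightCount_syndrome]
  have := hφ.card_weight_two hι hs
  omega

theorem TripleIndep.weightCount_eq (hφ : TripleIndep φ)
    (hι : Fintype.card ι = Fintype.card F + 2) {s : Fin 3 → F} (hs : IsFarSyndrome φ s) {w : ℕ}
    (hw : 3 ≤ w) (hwq : w ≤ Fintype.card F + 2) :
    (weightCount {x | φ x = s} w : ℤ) = weightCount (LinearMap.ker φ : Set (ι → F)) w
      - bonneauOmega (Fintype.card F + 2) 4 w 0
      + bonneauOmega (Fintype.card F + 2) 4 w 2 * (((Fintype.card F + 2) / 2 : ℕ) : ℤ) := by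
  have : Nonempty ι := Fintype.card_pos_iff.1 (by omega)
  have h := hφ.card_weight_sub hs (show 2 ≤ w by omega)
  have hsymm := choose_sub_two_eq (show 2 ≤ w by omega) hwq
  rw [show (LinearMap.ker φ : Set (ι → F)) = {x | φ x = 0} from rfl, bonneauOmega_four_zero hw hwq,
    bonneauOmega_four_two hw hwq, ← hφ.weightCount_two hι hs]
  simp only [weightCount_syndrome]
  rw [hι, Nat.add_sub_cancel] at h
  rw [Nat.add_sub_cancel, ← hsymm]
  linear_combination h

end Parameters

theorem mainTheorem10 {F : Type*} [Field F] [Fintype F] [DecidableEq F]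
    (q : ℕ) (hq : Fintype.card F = q) (hq_even : Even q)
    (α : Fin (q - 1) → F) (hα : Function.Injective α) (hα0 : ∀ i, α i ≠ 0)
    (v : Fin (q - 1) ⊕ Fin 3 → F) (hv : ∀ j, v j ≠ 0)
    (C : Submodule F (Fin (q - 1) ⊕ Fin 3 → F))
    (hC : C = parityCheckCode (gtrsMatrix α v)) :
    -- `C` is a `[q+2, q-1, 4]_q 2` code
    HasCodeParameters C (q + 2) (q - 1) 4 2 ∧
    -- the number of weight 2 cosets
    Set.ncard {V : Set (Fin (q - 1) ⊕ Fin 3 → F) | IsCosetOf C V ∧ cosetWeight V = 2}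
      = (q - 1) * (q ^ 2 - 1) ∧
    -- the weight distribution of every weight 2 coset
    (∀ V : Set (Fin (q - 1) ⊕ Fin 3 → F), IsCosetOf C V → cosetWeight V = 2 →
      weightCount V 0 = 0 ∧ weightCount V 1 = 0 ∧
      weightCount V 2 = (q + 2) / 2 ∧
      ∀ w : ℕ, 3 ≤ w → w ≤ q + 2 →
        (weightCount V w : ℤ) =
            (weightCount (C : Set (Fin (q - 1) ⊕ Fin 3 → F)) w : ℤ)
              - bonneauOmega (q + 2) 4 w 0
              + bonneauOmega (q + 2) 4 w 2 * (((q + 2) / 2 : ℕ) : ℤ) ∧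
        (weightCount V w : ℤ) =
            (weightCount (C : Set (Fin (q - 1) ⊕ Fin 3 → F)) w : ℤ)
              - bonneauOmega (q + 2) 4 w 0
              + (-1) ^ w * (q.choose (q + 2 - w) : ℤ) * (((q + 2) / 2 : ℕ) : ℤ)) ∧
    -- `C` is a perfect multiple covering of the farthest-off points
    IsPMCF C 2 ((q + 2) / 2) := by
  subst hq hC
  have hq1 := Fintype.one_lt_card (α := F)
  have : CharP F 2 := ringChar.of_eq (FiniteField.even_card_iff_char_two.2 (Nat.even_iff.1 hq_even))
  have hφ := tripleIndep_gtrsMatrix hα hα0 hv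
  have hι : Fintype.card (Fin (Fintype.card F - 1) ⊕ Fin 3) = Fintype.card F + 2 := by
    rw [Fintype.card_sum, Fintype.card_fin, Fintype.card_fin]
    omega
  have : Nonempty (Fin (Fintype.card F - 1) ⊕ Fin 3) := ⟨.inr 0⟩
  -- the code is the kernel of the syndrome map
  unfold parityCheckCode
  have hsurj := hφ.surjective (by omega)
  have hR := hφ.codeCoveringRadius_ker hι
  have hd := hφ.codeMinDist_ker (by omega)
  refine ⟨⟨hι, ?_, hd, hR⟩, hφ.ncard_cosets_weight_two hι, ?_, ⟨hR, fun x hx => ?_⟩, hd.ge⟩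
  · rw [hφ.finrank_ker (by omega), hι]
    omega
  · intro V hV hV2
    obtain ⟨s, rfl⟩ := (isCosetOf_ker_iff hsurj).1 hV
    have hs := (hφ.cosetWeight_eq_two_iff hι s).1 hV2
    refine ⟨hs.weightCount_eq_zero two_pos, hs.weightCount_eq_zero one_lt_two,
      hφ.weightCount_two hι hs, fun w hw hwq => ⟨hφ.weightCount_eq hι hs hw hwq, ?_⟩⟩
    rw [← bonneauOmega_four_two hw hwq]
    exact hφ.weightCount_eq hι hs hw hwq
  · rw [distToCode_ker, hφ.cosetWeight_eq_two_iff hι] at hx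
    rw [codewordsAtDist_ker, hφ.weightCount_two hι hx]
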